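/- All simplicial complexes are finite and abstract (families of finite sets closed under taking subsets; the empty set is a face of dimension $-1$ of every nonempty complex). A face $\sigma$ of a complex $K$ is \emph{$d$-collapsible} if $\dim\sigma\le d-1$ and $\sigma$ is contained in a unique inclusionwise maximal face $\tau$ of $K$; passing from $K$ to $K\setminus\{\eta\in K:\sigma\subseteq\eta\subseteq\tau\}$ is then an \emph{elementary $d$-collapse}. A complex $K$ \emph{$d$-collapses} to $L$ if $L$ arises from $K$ by a finite sequence of elementary $d$-collapses, and $K$ is \emph{$d$-collapsible} if it $d$-collapses to the complex $\emptyset$ without faces. Two faces $\omega,\eta$ of $K$ are \emph{distant} if every vertex of $\omega$ has graph distance at least $3$ from every vertex of $\eta$ in the $1$-skeleton of $K$ (the distance being $\infty$ between different components). Proposition. For every integer $d\ge 2$ there is a constant $c_d$ such that for every integer $t\ge 0$ there is a $d$-dimensional complex $C=C(\rho;\zeta_1,\dots,\zeta_t)$ with the following properties. (i) $C$ contains $(d-1)$-dimensional faces $\rho,\zeta_1,\dots,\zeta_t$, any two of which are distant. (ii) Let $C'=2^{\rho}\cup 2^{\zeta_1}\cup\dots\cup 2^{\zeta_t}$. Then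 $C$ $d$-collapses to $C'\setminus\{\rho\}$. In particular, $C$ is $d$-collapsible, since $C'\setminus\{\rho\}$ is $d$-collapsible. (iii) The only $d$-collapsible face of $C$ is $\rho$. (iv) The number of faces of $C$ is $O(t)$ for fixed $d$: it is at most $c_d\,t$ whenever $t\ge 1$. -/

import Mathlib

namespace DCollapse

/-- A finite abstract simplicial complex is given by its finite set of faces, which is a family of
finite sets of vertices closed under taking subsets. The empty set is a face of every nonempty
complex, and the family without any face is a complex, too. -/
def IsComplex {V : Type*} (K : Finset (Finset V)) : Prop :=
  ∀ A ∈ K, ∀ B : Finset V, B ⊆ A → B ∈ K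

/-- The dimension of a face; the empty face has dimension `-1`. -/
def faceDim {V : Type*} (σ : Finset V) : ℤ := (σ.card : ℤ) - 1

/-- The complex `K` is `d`-dimensional: `d` is the largest dimension of a face. -/
def HasDim {V : Type*} (K : Finset (Finset V)) (d : ℕ) : Prop :=
  (∃ σ ∈ K, faceDim σ = d) ∧ ∀ σ ∈ K, faceDim σ ≤ d

/-- `τ` is an inclusionwise maximal face of `K` that contains `σ`. -/
def IsMaximalFaceOver {V : Type*} (K : Finset (Finset V)) (σ τ : Finset V) : Prop :=
  Maximal (fun η => η ∈ K) τ ∧ σ ⊆ τ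

/-- `σ` is a `d`-collapsible face of `K`: a face of dimension at most `d - 1` that is contained in
a unique maximal face of `K`. -/
def IsCollapsibleFace {V : Type*} (d : ℕ) (K : Finset (Finset V)) (σ : Finset V) : Prop :=
  σ ∈ K ∧ faceDim σ ≤ (d : ℤ) - 1 ∧ ∃! τ, IsMaximalFaceOver K σ τ

/-- `L` arises from `K` by an elementary `d`-collapse: for some `d`-collapsible face `σ` of `K`,
with unique maximal face `τ` above it, `L` is `K` without the faces `η` with `σ ⊆ η ⊆ τ`. -/
def ElementaryCollapse {V : Type*} (d : ℕ) (K L : Finset (Finset V)) : Prop :=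
  ∃ σ τ, IsCollapsibleFace d K σ ∧ IsMaximalFaceOver K σ τ ∧
    ∀ η, η ∈ L ↔ η ∈ K ∧ ¬ (σ ⊆ η ∧ η ⊆ τ)

/-- `K` `d`-collapses to `L` by a finite sequence of elementary `d`-collapses. -/
def CollapsesTo {V : Type*} (d : ℕ) (K L : Finset (Finset V)) : Prop :=
  Relation.ReflTransGen (ElementaryCollapse d) K L

/-- `K` is `d`-collapsible: it `d`-collapses to the complex without faces. -/
def IsCollapsible {V : Type*} (d : ℕ) (K : Finset (Finset V)) : Prop :=
  CollapsesTo d K ∅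

/-- The graph of vertices and edges (the `1`-skeleton) of `K`. -/
def skeletonGraph {V : Type*} [DecidableEq V] (K : Finset (Finset V)) : SimpleGraph V where
  Adj u v := u ≠ v ∧ ({u, v} : Finset V) ∈ K
  symm := ⟨fun u v h => ⟨h.1.symm, by rw [Finset.pair_comm]; exact h.2⟩⟩
  loopless := ⟨fun _ h => h.1 rfl⟩

/-- Two faces of `K` are distant if every vertex of the one has graph distance at least `3`, in
the `1`-skeleton of `K`, from every vertex of the other (the distance is infinite between
different components). -/
def Distant {V : Type*} [DecidableEq V] (K : Finset (Finset V)) (ω η : Finset V) : Prop :=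
  ω ∈ K ∧ η ∈ K ∧ ∀ u ∈ ω, ∀ v ∈ η, 3 ≤ (skeletonGraph K).edist u v

/-- The complex `2^ρ ∪ 2^{ζ₁} ∪ ⋯ ∪ 2^{ζ_t}`. -/
def unionOfSimplices {V : Type*} [DecidableEq V] {t : ℕ} (ρ : Finset V) (ζ : Fin t → Finset V) :
    Finset (Finset V) :=
  ρ.powerset ∪ Finset.univ.biUnion (fun i => (ζ i).powerset)

end DCollapse

/-! The complex is a chain of `4 * t + 1` translates of one gadget depending only on `d`,
consecutive translates sharing a `d`-set: the exit of one is the entry of the next. In a gadget the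
entry is the only `d`-set contained in exactly one facet. Along the chain each later entry also lies
in a facet of the preceding translate, so only the first entry ρ stays free;
`isCollapsibleFace_generatedComplex_iff` turns this into (iii). The faces ζ are copies of a `target`
face in every fourth translate.

Collapses are encoded by an acyclic matching of the facets with `d`-subsets, the bases. Once the
facets are gone, the remaining faces have at most `d` vertices and can be removed at will, so every
subcomplex without bases is reachable (`generatedComplex_collapsesTo`). Exit and target are not
bases of their gadget; when a translate has been collapsed, its exit is free to start the next one.

The gadget comes from a walk `A 0, …, A (N - 1)` of `d`-sets and a vertex `n`. With S_j = A_j ∪ {n}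
and S_N = ∅, cone the mod 2 cycle ∂S_j + ∂S_{j+1} from a new apex a_j, for every j < N. A `d`-set
through an apex is not free, because the base of the cone is a cycle. A `d`-set B without apex lies
in the j-th cell exactly if the truth of B ⊆ S_j changes from j to j + 1. For `A 0` this happens
once, for a later `A j` twice; for B containing `n` it happens at least twice, since the walk
returns to every ridge of `A 0` that it left (`IsReturningWalk.ridge`). Removing `A j` opens the
j-th cone, whose collapse frees `A (j + 1)` (`IsReturningWalk.matching`). No `d`-set containing `n`
and contained in some S_j is ever a base, so exit and target are taken of this kind. -/

namespace DCollapse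

/-! ### Collapses along acyclic matchings. -/

section Collapses

variable {V : Type*}

theorem faceDim_le_iff (σ : Finset V) (d : ℕ) : faceDim σ ≤ (d : ℤ) - 1 ↔ σ.card ≤ d := by
  unfold faceDim; omega

theorem isMaximalFaceOver_of_forall {K : Finset (Finset V)} {σ τ : Finset V} (hτ : τ ∈ K)
    (hστ : σ ⊆ τ) (h : ∀ η ∈ K, σ ⊆ η → η ⊆ τ) : IsMaximalFaceOver K σ τ :=
  ⟨⟨hτ, fun η hη hle => h η hη (hστ.trans hle)⟩, hστ⟩

theorem isCollapsibleFace_of_forall {d : ℕ} {K : Finset (Finset V)} {σ τ : Finset V} (hσ : σ ∈ K)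
    (hd : σ.card ≤ d) (hτ : τ ∈ K) (hστ : σ ⊆ τ) (h : ∀ η ∈ K, σ ⊆ η → η ⊆ τ) :
    IsCollapsibleFace d K σ :=
  ⟨hσ, (faceDim_le_iff σ d).2 hd, τ, isMaximalFaceOver_of_forall hτ hστ h, fun τ' hτ' =>
    Finset.Subset.antisymm (h τ' hτ'.1.1 hτ'.2) (hτ'.1.2 hτ (h τ' hτ'.1.1 hτ'.2))⟩

/-- A family of `(d + 1)`-sets `facet i`, each with a `d`-subset `base i`, such that the facets can
be removed through their bases in the order of increasing rank. -/
structure IsAcyclicMatching {ι : Type*} (d : ℕ) (I : Finset ι) (facet base : ι → Finset V)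
    (rank : ι → ℕ) : Prop where
  card_facet : ∀ i ∈ I, (facet i).card = d + 1
  card_base : ∀ i ∈ I, (base i).card = d
  base_subset : ∀ i ∈ I, base i ⊆ facet i
  acyclic : ∀ i ∈ I, ∀ j ∈ I, base i ⊆ facet j → i = j ∨ rank j < rank i

variable {ι : Type*} {d : ℕ} {facet base : ι → Finset V} {rank : ι → ℕ} {I : Finset ι}

/-- Two indices with the same facet would each have to precede the other. -/
theorem IsAcyclicMatching.facet_inj (h : IsAcyclicMatching d I facet base rank) {i j : ι}
    (hi : i ∈ I) (hj : j ∈ I) (hij : facet i = facet j) : i = j := by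
  rcases h.acyclic i hi j hj (hij ▸ h.base_subset i hi) with h1 | h1
  · exact h1
  rcases h.acyclic j hj i hi (hij ▸ h.base_subset j hj) with h2 | h2
  · exact h2.symm
  · omega

variable [DecidableEq V]

/-- With at most one vertex between σ and τ, nothing lies strictly between them. The case σ = τ is
allowed and removes a single maximal face. -/
theorem elementaryCollapse_sdiff_pair {d : ℕ} {K : Finset (Finset V)} {σ τ : Finset V} (hσ : σ ∈ K)
    (hd : σ.card ≤ d) (hτ : τ ∈ K) (hστ : σ ⊆ τ) (hc : τ.card ≤ σ.card + 1)
    (h : ∀ η ∈ K, σ ⊆ η → η ⊆ τ) : ElementaryCollapse d K (K \ {σ, τ}) := by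
  refine ⟨σ, τ, isCollapsibleFace_of_forall hσ hd hτ hστ h, isMaximalFaceOver_of_forall hτ hστ h,
    fun η => ?_⟩
  simp only [Finset.mem_sdiff, Finset.mem_insert, Finset.mem_singleton]
  refine and_congr_right fun _ => not_congr ⟨?_, ?_⟩
  · rintro (rfl | rfl)
    · exact ⟨subset_rfl, hστ⟩
    · exact ⟨hστ, subset_rfl⟩
  · rintro ⟨h1, h2⟩
    by_contra hne
    push Not at hne
    have h3 := Finset.card_lt_card (h1.ssubset_of_ne (Ne.symm hne.1))
    have h4 := Finset.card_lt_card (h2.ssubset_of_ne hne.2)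
    omega

/-- A complex all of whose faces have at most `d` vertices `d`-collapses to each of its
subcomplexes. -/
theorem collapsesTo_of_card_le {d : ℕ} {L : Finset (Finset V)} (hL : IsComplex L) :
    ∀ (m : ℕ) (K : Finset (Finset V)), (K \ L).card = m → L ⊆ K → (∀ η ∈ K, η.card ≤ d) →
      CollapsesTo d K L := by
  intro m
  induction m with
  | zero =>
    intro K hK hLK _
    rw [Finset.card_eq_zero, Finset.sdiff_eq_empty_iff_subset] at hK
    rw [Finset.Subset.antisymm hK hLK]
    exact Relation.ReflTransGen.refl
  | succ m ih =>
    intro K hK hLK hd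
    -- A largest face outside `L` is maximal in `K`, because `L` is closed under subsets.
    obtain ⟨σ, hσ, hmax⟩ := Finset.exists_max_image (K \ L) Finset.card
      (Finset.card_pos.1 (by omega))
    have hσ' := Finset.mem_sdiff.1 hσ
    have hKσ : ElementaryCollapse d K (K \ {σ, σ}) := by
      refine elementaryCollapse_sdiff_pair hσ'.1 (hd σ hσ'.1) hσ'.1 subset_rfl (Nat.le_succ _) ?_
      intro η hη hση
      have hηL : η ∈ K \ L := Finset.mem_sdiff.2 ⟨hη, fun h => hσ'.2 (hL η h σ hση)⟩
      exact (Finset.eq_of_subset_of_card_le hση (hmax η hηL)).ge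
    refine Relation.ReflTransGen.head hKσ (ih _ ?_ ?_ fun η hη => hd η (Finset.mem_sdiff.1 hη).1)
    · have : (K \ {σ, σ}) \ L = (K \ L).erase σ := by
        ext η; simp only [Finset.mem_sdiff, Finset.mem_erase, Finset.mem_insert,
          Finset.mem_singleton]; tauto
      rw [this, Finset.card_erase_of_mem hσ, hK]; rfl
    · intro η hη
      refine Finset.mem_sdiff.2 ⟨hLK hη, fun h => hσ'.2 ?_⟩
      rw [Finset.mem_insert, Finset.mem_singleton, or_self] at h
      exact h ▸ hη

theorem isCollapsible_of_card_le {d : ℕ} {K : Finset (Finset V)} (hd : ∀ η ∈ K, η.card ≤ d) :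
    IsCollapsible d K :=
  collapsesTo_of_card_le (fun A hA => absurd hA (Finset.notMem_empty A)) _ K rfl
    (Finset.empty_subset K) hd

/-- A complex whose faces with more than `d` vertices are the facets of an acyclic matching
`d`-collapses to every subcomplex that contains no base and no facet. -/
theorem collapsesTo_of_isAcyclicMatching {L : Finset (Finset V)} (hL : IsComplex L) :
    ∀ (m : ℕ) (I : Finset ι) (K : Finset (Finset V)), I.card = m →
      IsAcyclicMatching d I facet base rank → L ⊆ K → IsComplex K →
      (∀ i ∈ I, facet i ∈ K) → (∀ η ∈ K, η.card ≤ d ∨ ∃ i ∈ I, η = facet i) →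
      (∀ i ∈ I, base i ∉ L) → CollapsesTo d K L := by
  classical
  intro m
  induction m with
  | zero =>
    intro I K hI _ hLK _ _ hd _
    rw [Finset.card_eq_zero] at hI
    refine collapsesTo_of_card_le hL _ K rfl hLK fun η hη => ?_
    rcases hd η hη with h | ⟨i, hi, -⟩
    · exact h
    · simp [hI] at hi
  | succ m ih =>
    intro I K hI hM hLK hK hF hd hB
    -- The base of least rank lies in no other remaining facet, so its facet can go.
    obtain ⟨i, hi, hmin⟩ := Finset.exists_min_image I rank (Finset.card_pos.1 (by omega))
    have hbi : base i ∈ K := hK _ (hF i hi) _ (hM.base_subset i hi)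
    have hstep : ElementaryCollapse d K (K \ {base i, facet i}) := by
      refine elementaryCollapse_sdiff_pair hbi (hM.card_base i hi).le (hF i hi)
        (hM.base_subset i hi) (by rw [hM.card_facet i hi, hM.card_base i hi]) fun η hη hbη => ?_
      rcases hd η hη with h | ⟨j, hj, rfl⟩
      · rw [← Finset.eq_of_subset_of_card_le hbη (by rw [hM.card_base i hi]; exact h)]
        exact hM.base_subset i hi
      · rcases hM.acyclic i hi j hj hbη with rfl | h
        · exact subset_rfl
        · exact absurd (hmin j hj) (by omega)
    have hnotin : ∀ j ∈ I.erase i, ¬ base i ⊆ facet j := fun j hj hbj => by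
      rcases hM.acyclic i hi j (Finset.mem_of_mem_erase hj) hbj with rfl | h
      · simp at hj
      · exact absurd (hmin j (Finset.mem_of_mem_erase hj)) (by omega)
    refine Relation.ReflTransGen.head hstep (ih (I.erase i) _ ?_ ?_ ?_ ?_ ?_ ?_ ?_)
    · rw [Finset.card_erase_of_mem hi, hI]; rfl
    · exact ⟨fun j hj => hM.card_facet j (Finset.mem_of_mem_erase hj),
        fun j hj => hM.card_base j (Finset.mem_of_mem_erase hj),
        fun j hj => hM.base_subset j (Finset.mem_of_mem_erase hj),
        fun j hj k hk => hM.acyclic j (Finset.mem_of_mem_erase hj) k (Finset.mem_of_mem_erase hk)⟩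
    · intro η hη
      refine Finset.mem_sdiff.2 ⟨hLK hη, fun h => ?_⟩
      rcases Finset.mem_insert.1 h with rfl | h
      · exact hB i hi hη
      · rw [Finset.mem_singleton.1 h] at hη
        exact hB i hi (hL _ hη _ (hM.base_subset i hi))
    · intro A hA B hBA
      rw [Finset.mem_sdiff] at hA ⊢
      refine ⟨hK A hA.1 B hBA, fun h => hA.2 ?_⟩
      have hbA : base i ⊆ A := by
        rcases Finset.mem_insert.1 h with rfl | h
        · exact hBA
        · rw [Finset.mem_singleton.1 h] at hBA
          exact (hM.base_subset i hi).trans hBA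
      rcases hd A hA.1 with h' | ⟨j, hj, rfl⟩
      · rw [← Finset.eq_of_subset_of_card_le hbA (by rw [hM.card_base i hi]; exact h')]
        exact Finset.mem_insert_self _ _
      · by_cases hji : j = i
        · simp [hji]
        · exact absurd hbA (hnotin j (Finset.mem_erase.2 ⟨hji, hj⟩))
    · intro j hj
      refine Finset.mem_sdiff.2 ⟨hF j (Finset.mem_of_mem_erase hj), fun h => hnotin j hj ?_⟩
      rcases Finset.mem_insert.1 h with h | h
      · exact h.ge
      · rw [Finset.mem_singleton.1 h]
        exact hM.base_subset i hi
    · intro η hη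
      rw [Finset.mem_sdiff] at hη
      rcases hd η hη.1 with h | ⟨j, hj, rfl⟩
      · exact Or.inl h
      · refine Or.inr ⟨j, Finset.mem_erase.2 ⟨?_, hj⟩, rfl⟩
        rintro rfl
        exact hη.2 (by simp)
    · exact fun j hj => hB j (Finset.mem_of_mem_erase hj)

end Collapses

/-! ### Pure complexes given by their facets. -/

section GeneratedComplex

variable {V ι : Type*} [DecidableEq V]

/-- The complex generated by the faces `facet i`, `i ∈ I`. -/
def generatedComplex (I : Finset ι) (facet : ι → Finset V) : Finset (Finset V) :=
  I.biUnion fun i => (facet i).powerset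

variable {d : ℕ} {facet base : ι → Finset V} {rank : ι → ℕ} {I : Finset ι}

theorem mem_generatedComplex {η : Finset V} :
    η ∈ generatedComplex I facet ↔ ∃ i ∈ I, η ⊆ facet i := by
  simp [generatedComplex]

theorem isComplex_generatedComplex : IsComplex (generatedComplex I facet) := by
  intro A hA B hBA
  obtain ⟨i, hi, h⟩ := mem_generatedComplex.1 hA
  exact mem_generatedComplex.2 ⟨i, hi, hBA.trans h⟩

theorem hasDim_generatedComplex (hcard : ∀ i ∈ I, (facet i).card = d + 1) (hI : I.Nonempty) :
    HasDim (generatedComplex I facet) d := by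
  constructor
  · obtain ⟨i, hi⟩ := hI
    refine ⟨facet i, mem_generatedComplex.2 ⟨i, hi, subset_rfl⟩, ?_⟩
    simp [faceDim, hcard i hi]
  · intro σ hσ
    obtain ⟨i, hi, h⟩ := mem_generatedComplex.1 hσ
    have := Finset.card_le_card h
    rw [hcard i hi] at this
    unfold faceDim
    omega

theorem card_generatedComplex_le (hcard : ∀ i ∈ I, (facet i).card = d + 1) :
    (generatedComplex I facet).card ≤ I.card * 2 ^ (d + 1) :=
  Finset.card_biUnion_le_card_mul _ _ _ fun i hi => by rw [Finset.card_powerset, hcard i hi]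

theorem generatedComplex_collapsesTo (hM : IsAcyclicMatching d I facet base rank)
    {L : Finset (Finset V)} (hL : IsComplex L) (hLK : L ⊆ generatedComplex I facet)
    (hB : ∀ i ∈ I, base i ∉ L) : CollapsesTo d (generatedComplex I facet) L := by
  refine collapsesTo_of_isAcyclicMatching hL _ I _ rfl hM hLK isComplex_generatedComplex
    (fun i hi => mem_generatedComplex.2 ⟨i, hi, subset_rfl⟩) (fun η hη => ?_) hB
  obtain ⟨i, hi, h⟩ := mem_generatedComplex.1 hη
  by_cases hc : η.card ≤ d
  · exact Or.inl hc
  · exact Or.inr ⟨i, hi, Finset.eq_of_subset_of_card_le h (by rw [hM.card_facet i hi]; omega)⟩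

theorem isMaximalFaceOver_facet (hcard : ∀ i ∈ I, (facet i).card = d + 1) {i : ι} (hi : i ∈ I)
    {σ : Finset V} (hσ : σ ⊆ facet i) : IsMaximalFaceOver (generatedComplex I facet) σ (facet i) := by
  refine ⟨⟨mem_generatedComplex.2 ⟨i, hi, subset_rfl⟩, fun η hη hle => ?_⟩, hσ⟩
  obtain ⟨j, hj, h⟩ := mem_generatedComplex.1 hη
  refine (Finset.eq_of_subset_of_card_le hle ?_).ge
  rw [hcard i hi, ← hcard j hj]
  exact Finset.card_le_card h

/-- If `ρ` is the only `d`-set that lies in exactly one facet then it is the only `d`-collapsible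
face. -/
theorem isCollapsibleFace_generatedComplex_iff (hM : IsAcyclicMatching d I facet base rank)
    {ρ : Finset V} (hρ : ρ.card = d) {i₀ : ι} (hi₀ : i₀ ∈ I) (hρi₀ : ρ ⊆ facet i₀)
    (huniq : ∀ i ∈ I, ρ ⊆ facet i → i = i₀)
    (hridge : ∀ i ∈ I, ∀ B ⊆ facet i, B.card = d → B ≠ ρ →
      ∃ j ∈ I, ∃ k ∈ I, j ≠ k ∧ B ⊆ facet j ∧ B ⊆ facet k) (σ : Finset V) :
    IsCollapsibleFace d (generatedComplex I facet) σ ↔ σ = ρ := by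
  constructor
  · rintro ⟨hσ, hd, τ, -, hτ⟩
    rw [faceDim_le_iff] at hd
    obtain ⟨i, hi, hσi⟩ := mem_generatedComplex.1 hσ
    by_contra hne
    -- A face with fewer than `d` vertices has at least two `d`-supersets in the facet, obtained by
    -- dropping `x` or `y`, and at most one of them is ρ.
    obtain ⟨B, hσB, hBi, hBd, hBρ⟩ : ∃ B, σ ⊆ B ∧ B ⊆ facet i ∧ B.card = d ∧ B ≠ ρ := by
      rcases hd.eq_or_lt with hd | hd
      · exact ⟨σ, subset_rfl, hσi, hd, hne⟩
      · have h2 : 1 < (facet i \ σ).card := by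
          rw [Finset.card_sdiff_of_subset hσi, hM.card_facet i hi]; omega
        obtain ⟨x, hx, y, hy, hxy⟩ := Finset.one_lt_card.1 h2
        rw [Finset.mem_sdiff] at hx hy
        have key : ∀ z ∈ facet i, z ∉ σ → σ ⊆ (facet i).erase z ∧ (facet i).erase z ⊆ facet i ∧
            ((facet i).erase z).card = d := fun z hz hzσ =>
          ⟨Finset.subset_erase.2 ⟨hσi, hzσ⟩, Finset.erase_subset _ _, by
            rw [Finset.card_erase_of_mem hz, hM.card_facet i hi]; rfl⟩
        by_cases hxρ : (facet i).erase x = ρ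
        · obtain ⟨h1, h2, h3⟩ := key y hy.1 hy.2
          refine ⟨_, h1, h2, h3, fun h => ?_⟩
          have : y ∈ (facet i).erase x := Finset.mem_erase.2 ⟨hxy.symm, hy.1⟩
          rw [hxρ, ← h] at this
          simp at this
        · obtain ⟨h1, h2, h3⟩ := key x hx.1 hx.2
          exact ⟨_, h1, h2, h3, hxρ⟩
    obtain ⟨j, hj, k, hk, hjk, hBj, hBk⟩ := hridge i hi B hBi hBd hBρ
    refine hjk (hM.facet_inj hj hk ?_)
    rw [hτ _ (isMaximalFaceOver_facet hM.card_facet hj (hσB.trans hBj)),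
      hτ _ (isMaximalFaceOver_facet hM.card_facet hk (hσB.trans hBk))]
  · rintro rfl
    refine isCollapsibleFace_of_forall (τ := facet i₀) (mem_generatedComplex.2 ⟨i₀, hi₀, hρi₀⟩)
      hρ.le (mem_generatedComplex.2 ⟨i₀, hi₀, subset_rfl⟩) hρi₀ fun η hη hση => ?_
    obtain ⟨j, hj, h⟩ := mem_generatedComplex.1 hη
    rwa [huniq j hj (hση.trans h)] at h

end GeneratedComplex

/-! ### The complex C' without ρ. -/

section UnionOfSimplices

variable {V : Type*} [DecidableEq V] {t d : ℕ} {ρ : Finset V} {ζ : Fin t → Finset V}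

theorem mem_unionOfSimplices {η : Finset V} :
    η ∈ unionOfSimplices ρ ζ ↔ η ⊆ ρ ∨ ∃ i, η ⊆ ζ i := by
  simp [unionOfSimplices]

theorem card_le_of_mem_unionOfSimplices (hρ : ρ.card = d) (hζ : ∀ i, (ζ i).card = d)
    {η : Finset V} (hη : η ∈ unionOfSimplices ρ ζ) : η.card ≤ d := by
  rcases mem_unionOfSimplices.1 hη with h | ⟨i, h⟩
  · exact hρ ▸ Finset.card_le_card h
  · exact hζ i ▸ Finset.card_le_card h

theorem isComplex_unionOfSimplices_sdiff (hρ : ρ.card = d) (hζ : ∀ i, (ζ i).card = d) :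
    IsComplex (unionOfSimplices ρ ζ \ {ρ}) := by
  intro A hA B hBA
  rw [Finset.mem_sdiff, Finset.mem_singleton] at hA ⊢
  constructor
  · rcases mem_unionOfSimplices.1 hA.1 with h | ⟨i, h⟩
    · exact mem_unionOfSimplices.2 (Or.inl (hBA.trans h))
    · exact mem_unionOfSimplices.2 (Or.inr ⟨i, hBA.trans h⟩)
  · rintro rfl
    exact hA.2 (Finset.eq_of_subset_of_card_le hBA
      (hρ ▸ card_le_of_mem_unionOfSimplices hρ hζ hA.1)).symm

/-- Reduces the claim that no base lies in the remaining complex to a comparison of bases with the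
ζ. -/
theorem eq_of_mem_unionOfSimplices_sdiff (hρ : ρ.card = d) (hζ : ∀ i, (ζ i).card = d)
    {η : Finset V} (hη : η ∈ unionOfSimplices ρ ζ \ {ρ}) (hd : η.card = d) : ∃ i, η = ζ i := by
  rw [Finset.mem_sdiff, Finset.mem_singleton] at hη
  rcases mem_unionOfSimplices.1 hη.1 with h | ⟨i, h⟩
  · exact absurd (Finset.eq_of_subset_of_card_le h (by omega)) hη.2
  · exact ⟨i, Finset.eq_of_subset_of_card_le h (by rw [hζ i, hd])⟩

end UnionOfSimplices

/-! ### Lower bounds on graph distance. -/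

section Levels

variable {V : Type*} [DecidableEq V] {K : Finset (Finset V)}

/-- The hypothesis also covers the reversed edge, as `{u, v}` is unordered; a level thus changes by
at most one per step of a walk. -/
theorem level_le_add_length {level : V → ℕ}
    (h : ∀ u v, ({u, v} : Finset V) ∈ K → level v ≤ level u + 1) {u v : V}
    (p : (skeletonGraph K).Walk u v) : level v ≤ level u + p.length := by
  induction p with
  | nil => simp
  | cons hadj p ih =>
    have := h _ _ hadj.2
    rw [SimpleGraph.Walk.length_cons]
    omega

theorem three_le_edist_of_level {level : V → ℕ}
    (h : ∀ u v, ({u, v} : Finset V) ∈ K → level v ≤ level u + 1) {u v : V}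
    (huv : level u + 3 ≤ level v) : 3 ≤ (skeletonGraph K).edist u v := by
  refine le_iInf fun p => ?_
  have := level_le_add_length h p
  exact_mod_cast (by omega : 3 ≤ p.length)

end Levels

end DCollapse

/-! ### Translates and the interface of a gadget. -/

namespace DCollapse

/-- The translate of a set of natural numbers by `c`. -/
def translate (c : ℕ) (S : Finset ℕ) : Finset ℕ := S.map (addRightEmbedding c)

theorem mem_translate {c x : ℕ} {S : Finset ℕ} : x ∈ translate c S ↔ c ≤ x ∧ x - c ∈ S := by
  simp only [translate, Finset.mem_map, addRightEmbedding_apply]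
  constructor
  · rintro ⟨y, hy, rfl⟩
    exact ⟨Nat.le_add_left _ _, by rwa [Nat.add_sub_cancel]⟩
  · rintro ⟨h1, h2⟩
    exact ⟨x - c, h2, Nat.sub_add_cancel h1⟩

theorem card_translate (c : ℕ) (S : Finset ℕ) : (translate c S).card = S.card :=
  Finset.card_map _

theorem translate_subset_translate {c : ℕ} {S T : Finset ℕ} :
    translate c S ⊆ translate c T ↔ S ⊆ T :=
  Finset.map_subset_map

theorem translate_injective (c : ℕ) : Function.Injective (translate c) :=
  Finset.map_injective _

theorem exists_eq_translate {c : ℕ} {B S : Finset ℕ} (h : B ⊆ translate c S) :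
    ∃ B' ⊆ S, B = translate c B' := by
  obtain ⟨B', h1, h2⟩ := Finset.subset_map_iff.1 h
  exact ⟨B', h1, h2⟩

/-- A `d`-dimensional complex with vertices below `L + d`, given by its facets and an acyclic
matching. The face `{0, …, d - 1}` is the base of the facet `start`, and it is the only
`d`-set that lies in exactly one facet; the faces `{L, …, L + d - 1}` and `target` are not bases. -/
structure Gadget (d L : ℕ) where
  ι : Type
  I : Finset ι
  facet : ι → Finset ℕ
  base : ι → Finset ℕ
  rank : ι → ℕ
  matching : IsAcyclicMatching d I facet base rank
  facet_lt : ∀ i ∈ I, ∀ x ∈ facet i, x < L + d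
  start : ι
  start_mem : start ∈ I
  base_start : base start = Finset.range d
  eq_start : ∀ i ∈ I, Finset.range d ⊆ facet i → i = start
  ridge : ∀ i ∈ I, ∀ B ⊆ facet i, B.card = d → B ≠ Finset.range d →
    ∃ j ∈ I, ∃ k ∈ I, j ≠ k ∧ B ⊆ facet j ∧ B ⊆ facet k
  exit_subset : ∃ i ∈ I, Finset.Ico L (L + d) ⊆ facet i
  base_ne_exit : ∀ i ∈ I, base i ≠ Finset.Ico L (L + d)
  target : Finset ℕ
  card_target : target.card = d
  target_subset : ∃ i ∈ I, target ⊆ facet i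
  base_ne_target : ∀ i ∈ I, base i ≠ target
  target_ne_exit : target ≠ Finset.Ico L (L + d)

/-- A translate meets the range of a later one in at most the `d` numbers of its exit, so a `d`-set
inside this overlap fills it. -/
theorem eq_Ico_of_translate_ge {d L k k' : ℕ} {S : Finset ℕ}
    (hS : S.card = d) (hlt : ∀ x ∈ S, x < L + d) (hk : k < k')
    (h : ∀ x ∈ translate (k * L) S, k' * L ≤ x) : S = Finset.Ico L (L + d) := by
  have hkL : k * L + L ≤ k' * L := by nlinarith
  refine Finset.eq_of_subset_of_card_le (fun x hx => ?_) (by rw [hS, Nat.card_Ico]; omega)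
  have h1 := h _ (mem_translate.2 ⟨Nat.le_add_left (k * L) x, by rwa [Nat.add_sub_cancel]⟩)
  have h2 := hlt x hx
  rw [Finset.mem_Ico]
  omega

theorem translate_Ico_eq (d L k : ℕ) :
    translate (k * L) (Finset.Ico L (L + d)) = translate ((k + 1) * L) (Finset.range d) := by
  ext x
  simp only [mem_translate, Finset.mem_Ico, Finset.mem_range, Nat.succ_mul]
  omega

/-! ### Chains of translated gadgets. -/

namespace Gadget

variable {d L : ℕ} (G : Gadget d L)

/-- The index set of the chain of `M` translates of a gadget. -/
def chainIndex (M : ℕ) : Finset (ℕ × G.ι) := Finset.range M ×ˢ G.I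

/-- The facets of a chain of translates: consecutive gadgets share a face with `d` vertices. -/
def chainFacet (p : ℕ × G.ι) : Finset ℕ := translate (p.1 * L) (G.facet p.2)

/-- The bases of the facets of a chain. -/
def chainBase (p : ℕ × G.ι) : Finset ℕ := translate (p.1 * L) (G.base p.2)

/-- The ranks of the facets of a chain. -/
def chainRank (p : ℕ × G.ι) : ℕ := p.1 * (G.I.sup G.rank + 1) + G.rank p.2

variable {G} {M : ℕ}

theorem mem_chainIndex {p : ℕ × G.ι} : p ∈ G.chainIndex M ↔ p.1 < M ∧ p.2 ∈ G.I := by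
  simp [chainIndex]

theorem mem_chainFacet_bounds {p : ℕ × G.ι} (hp : p.2 ∈ G.I) {x : ℕ} (hx : x ∈ G.chainFacet p) :
    p.1 * L ≤ x ∧ x < p.1 * L + (L + d) := by
  obtain ⟨h1, h2⟩ := mem_translate.1 hx
  have := G.facet_lt _ hp _ h2
  omega

theorem base_lt {i : G.ι} (hi : i ∈ G.I) : ∀ x ∈ G.base i, x < L + d := fun x hx =>
  G.facet_lt i hi x (G.matching.base_subset i hi hx)

/-- The translates are collapsed one after the other. A base of an earlier translate cannot lie in a
facet of a later one, as it would be the exit; a base of a later translate may lie in an earlier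
facet, which is removed before. -/
theorem chain_matching :
    IsAcyclicMatching d (G.chainIndex M) G.chainFacet G.chainBase G.chainRank where
  card_facet p hp := by
    rw [chainFacet, card_translate, G.matching.card_facet _ (mem_chainIndex.1 hp).2]
  card_base p hp := by
    rw [chainBase, card_translate, G.matching.card_base _ (mem_chainIndex.1 hp).2]
  base_subset p hp :=
    translate_subset_translate.2 (G.matching.base_subset _ (mem_chainIndex.1 hp).2)
  acyclic := by
    rintro ⟨k, i⟩ hp ⟨l, j⟩ hq h
    have hi := (mem_chainIndex.1 hp).2
    have hj := (mem_chainIndex.1 hq).2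
    dsimp only at hi hj
    rcases lt_trichotomy k l with hkl | rfl | hkl
    · exact absurd (eq_Ico_of_translate_ge (G.matching.card_base i hi) (base_lt hi) hkl
        fun x hx => (mem_chainFacet_bounds hj (h hx)).1) (G.base_ne_exit i hi)
    · rcases G.matching.acyclic i hi j hj (translate_subset_translate.1 h) with rfl | h
      · exact Or.inl rfl
      · exact Or.inr (Nat.add_lt_add_left h _)
    · right
      -- The factor `G.I.sup G.rank + 1` puts every rank in translate `l` below every rank in
      -- translate `k`.
      have h1 : G.rank j ≤ G.I.sup G.rank := Finset.le_sup hj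
      have h2 : (l + 1) * (G.I.sup G.rank + 1) ≤ k * (G.I.sup G.rank + 1) :=
        Nat.mul_le_mul_right _ hkl
      rw [Nat.succ_mul] at h2
      simp only [chainRank]
      omega

theorem range_subset_facet_start : Finset.range d ⊆ G.facet G.start :=
  G.base_start ▸ G.matching.base_subset _ G.start_mem

theorem chain_eq_start (hd : 0 < d) (hdL : d ≤ L) {p : ℕ × G.ι} (hp : p ∈ G.chainIndex M)
    (h : Finset.range d ⊆ G.chainFacet p) : p = (0, G.start) := by
  obtain ⟨k, i⟩ := p
  have hi := (mem_chainIndex.1 hp).2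
  dsimp only at hi
  have h0 := (mem_chainFacet_bounds hi (h (Finset.mem_range.2 hd))).1
  have hk : k = 0 := by
    rcases Nat.mul_eq_zero.1 (Nat.le_zero.1 h0) with h | h
    · exact h
    · omega
  subst hk
  have : i = G.start := by
    refine G.eq_start i hi fun x hx => ?_
    have := (mem_translate.1 (h hx)).2
    simpa using this
  rw [this]

/-- Only entries need more than the ridge property of one gadget: the entry of translate `k + 1`
gets its second facet from translate `k`, as the exit there. -/
theorem chain_ridge {p : ℕ × G.ι} (hp : p ∈ G.chainIndex M)
    {B : Finset ℕ} (hBp : B ⊆ G.chainFacet p) (hB : B.card = d) (hne : B ≠ Finset.range d) :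
    ∃ q ∈ G.chainIndex M, ∃ r ∈ G.chainIndex M, q ≠ r ∧ B ⊆ G.chainFacet q ∧
      B ⊆ G.chainFacet r := by
  obtain ⟨k, i⟩ := p
  obtain ⟨hk, hi⟩ := mem_chainIndex.1 hp
  dsimp only at hk hi
  obtain ⟨B, hB', rfl⟩ := exists_eq_translate hBp
  rw [card_translate] at hB
  dsimp only at *
  by_cases hBr : B = Finset.range d
  · subst hBr
    cases k with
    | zero =>
      refine absurd ?_ hne
      ext x; simp [mem_translate]
    | succ k =>
      obtain ⟨j, hj, hexit⟩ := G.exit_subset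
      refine ⟨(k + 1, i), mem_chainIndex.2 ⟨hk, hi⟩, (k, j), mem_chainIndex.2 ⟨by dsimp; omega, hj⟩,
        by simp, hBp, ?_⟩
      rw [← translate_Ico_eq]
      exact translate_subset_translate.2 hexit
  · obtain ⟨j, hj, l, hl, hjl, h1, h2⟩ := G.ridge i hi B hB' hB hBr
    exact ⟨(k, j), mem_chainIndex.2 ⟨hk, hj⟩, (k, l), mem_chainIndex.2 ⟨hk, hl⟩,
      fun h => hjl (Prod.ext_iff.1 h).2, translate_subset_translate.2 h1,
      translate_subset_translate.2 h2⟩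

/-- A base and a target of different translates can agree only in an exit of the earlier one, but
neither a base nor the target of that translate is its exit. -/
theorem chainBase_ne_target {p : ℕ × G.ι} (hp : p ∈ G.chainIndex M)
    (l : ℕ) : G.chainBase p ≠ translate (l * L) G.target := by
  obtain ⟨k, i⟩ := p
  have hi := (mem_chainIndex.1 hp).2
  dsimp only at hi
  obtain ⟨j, hj, hjt⟩ := G.target_subset
  intro h
  rcases lt_trichotomy k l with hkl | rfl | hkl
  · refine G.base_ne_exit i hi (eq_Ico_of_translate_ge (G.matching.card_base i hi)
      (base_lt hi) hkl fun x hx => ?_)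
    exact (mem_translate.1 (h ▸ hx : x ∈ translate (l * L) G.target)).1
  · exact G.base_ne_target i hi (translate_injective _ h)
  · refine G.target_ne_exit (eq_Ico_of_translate_ge G.card_target
      (fun x hx => G.facet_lt j hj x (hjt hx)) hkl fun x hx => ?_)
    exact (mem_translate.1 (h ▸ hx : x ∈ G.chainBase (k, i))).1

/-- As d ≤ L, the k-th translate lies in [kL, (k + 2)L). Hence `x / L` serves as the level for the
distance bounds. -/
theorem div_level_of_mem_chainFacet (hd : 0 < d) (hdL : d ≤ L) {p : ℕ × G.ι} (hp : p.2 ∈ G.I) {x : ℕ}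
    (hx : x ∈ G.chainFacet p) : p.1 ≤ x / L ∧ x / L ≤ p.1 + 1 := by
  have hL : 0 < L := by omega
  obtain ⟨h1, h2⟩ := mem_chainFacet_bounds hp hx
  refine ⟨(Nat.le_div_iff_mul_le hL).2 h1, Nat.lt_succ_iff.1 ((Nat.div_lt_iff_lt_mul hL).2 ?_)⟩
  simp only [Nat.succ_mul]
  omega

theorem div_level_le_succ (hd : 0 < d) (hdL : d ≤ L) (u v : ℕ)
    (h : ({u, v} : Finset ℕ) ∈ generatedComplex (G.chainIndex M) G.chainFacet) :
    v / L ≤ u / L + 1 := by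
  obtain ⟨p, hp, h⟩ := mem_generatedComplex.1 h
  have hu := div_level_of_mem_chainFacet hd hdL (mem_chainIndex.1 hp).2 (h (by simp : u ∈ _))
  have hv := div_level_of_mem_chainFacet hd hdL (mem_chainIndex.1 hp).2 (h (by simp : v ∈ _))
  omega

theorem div_level_target (hd : 0 < d) (hdL : d ≤ L) (k : ℕ) {x : ℕ}
    (hx : x ∈ translate (k * L) G.target) : k ≤ x / L ∧ x / L ≤ k + 1 := by
  obtain ⟨j, hj, hjt⟩ := G.target_subset
  exact div_level_of_mem_chainFacet (p := (k, j)) hd hdL hj (translate_subset_translate.2 hjt hx)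

theorem translate_target_mem {k : ℕ} (hk : k < M) :
    translate (k * L) G.target ∈ generatedComplex (G.chainIndex M) G.chainFacet := by
  obtain ⟨j, hj, hjt⟩ := G.target_subset
  exact mem_generatedComplex.2 ⟨(k, j), mem_chainIndex.2 ⟨hk, hj⟩,
    translate_subset_translate.2 hjt⟩

theorem range_mem (hM : 0 < M) :
    Finset.range d ∈ generatedComplex (G.chainIndex M) G.chainFacet := by
  refine mem_generatedComplex.2 ⟨(0, G.start), mem_chainIndex.2 ⟨hM, G.start_mem⟩, fun x hx => ?_⟩
  simpa [chainFacet, mem_translate] using range_subset_facet_start hx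

theorem distant_range_target (hd : 0 < d) (hdL : d ≤ L) {k : ℕ} (hk : k < M) (h3 : 3 ≤ k) :
    Distant (generatedComplex (G.chainIndex M) G.chainFacet) (Finset.range d)
      (translate (k * L) G.target) := by
  refine ⟨range_mem (by omega), translate_target_mem hk, fun u hu v hv => ?_⟩
  refine three_le_edist_of_level (level := (· / L)) (div_level_le_succ hd hdL) ?_
  have h1 := (div_level_target hd hdL k hv).1
  have h2 : u / L = 0 := Nat.div_eq_of_lt (by rw [Finset.mem_range] at hu; omega)
  omega

theorem distant_target_target (hd : 0 < d) (hdL : d ≤ L) {k l : ℕ} (hk : k < M) (hl : l < M)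
    (hkl : k + 4 ≤ l ∨ l + 4 ≤ k) :
    Distant (generatedComplex (G.chainIndex M) G.chainFacet) (translate (k * L) G.target)
      (translate (l * L) G.target) := by
  refine ⟨translate_target_mem hk, translate_target_mem hl, fun u hu v hv => ?_⟩
  have h1 := div_level_target hd hdL k hu
  have h2 := div_level_target hd hdL l hv
  rcases hkl with h | h
  · exact three_le_edist_of_level (level := (· / L)) (div_level_le_succ hd hdL) (by omega)
  · rw [SimpleGraph.edist_comm]
    exact three_le_edist_of_level (level := (· / L)) (div_level_le_succ hd hdL) (by omega)

theorem exists_complex (G : Gadget d L) (hd : 0 < d) (hdL : d ≤ L) :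
    ∃ c : ℕ, ∀ t : ℕ,
      ∃ (V : Type) (_ : DecidableEq V) (C : Finset (Finset V))
        (ρ : Finset V) (ζ : Fin t → Finset V),
        IsComplex C ∧ HasDim C d ∧
        (ρ ∈ C ∧ faceDim ρ = (d : ℤ) - 1 ∧
          (∀ i, ζ i ∈ C ∧ faceDim (ζ i) = (d : ℤ) - 1) ∧
          (∀ i, Distant C ρ (ζ i)) ∧
          (∀ i j, i ≠ j → Distant C (ζ i) (ζ j))) ∧
        (CollapsesTo d C (unionOfSimplices ρ ζ \ {ρ}) ∧
          IsCollapsible d (unionOfSimplices ρ ζ \ {ρ}) ∧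
          IsCollapsible d C) ∧
        (∀ σ, IsCollapsibleFace d C σ ↔ σ = ρ) ∧
        (1 ≤ t → C.card ≤ c * t) := by
  refine ⟨5 * (G.I.card * 2 ^ (d + 1)), fun t => ?_⟩
  -- The targets sit in the translates 4, 8, …, 4t. The k-th translate has levels k and k + 1, so a
  -- shift by 4 leaves a gap of 3. For t ≥ 1 there are at most 5t translates, whence the factor 5.
  set M := 4 * t + 1 with hMdef
  have hM : IsAcyclicMatching d (G.chainIndex M) G.chainFacet G.chainBase G.chainRank :=
    chain_matching
  set ζ : Fin t → Finset ℕ := fun i => translate ((4 * (i.1 + 1)) * L) G.target with hζdef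
  have hζ : ∀ i, (ζ i).card = d := fun i => by rw [hζdef, card_translate, G.card_target]
  have hζM : ∀ i : Fin t, 4 * (i.1 + 1) < M := fun i => by have := i.2; omega
  have hρ : (Finset.range d).card = d := Finset.card_range d
  have hρC := range_mem (G := G) (M := M) (by omega)
  have hL : IsComplex (unionOfSimplices (Finset.range d) ζ \ {Finset.range d}) :=
    isComplex_unionOfSimplices_sdiff hρ hζ
  have hsub : unionOfSimplices (Finset.range d) ζ \ {Finset.range d} ⊆
      generatedComplex (G.chainIndex M) G.chainFacet := by
    intro η hη
    rcases mem_unionOfSimplices.1 (Finset.mem_sdiff.1 hη).1 with h | ⟨i, h⟩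
    · exact isComplex_generatedComplex _ hρC _ h
    · exact isComplex_generatedComplex _ (translate_target_mem (hζM i)) _ h
  have hcol := generatedComplex_collapsesTo hM hL hsub fun p hp hmem => by
    obtain ⟨i, hi⟩ := eq_of_mem_unionOfSimplices_sdiff hρ hζ hmem (hM.card_base p hp)
    exact chainBase_ne_target hp _ hi
  have hLc : IsCollapsible d (unionOfSimplices (Finset.range d) ζ \ {Finset.range d}) :=
    isCollapsible_of_card_le fun η hη =>
      card_le_of_mem_unionOfSimplices hρ hζ (Finset.mem_sdiff.1 hη).1
  have hstart : (0, G.start) ∈ G.chainIndex M := mem_chainIndex.2 ⟨by dsimp; omega, G.start_mem⟩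
  refine ⟨ℕ, inferInstance, generatedComplex (G.chainIndex M) G.chainFacet, Finset.range d, ζ,
    isComplex_generatedComplex, hasDim_generatedComplex hM.card_facet ⟨_, hstart⟩,
    ⟨hρC, by rw [faceDim, hρ], fun i => ⟨translate_target_mem (hζM i), by rw [faceDim, hζ i]⟩,
      fun i => distant_range_target hd hdL (hζM i) (by omega), fun i j hij =>
      distant_target_target hd hdL (hζM i) (hζM j) ?_⟩,
    ⟨hcol, hLc, hcol.trans hLc⟩, ?_, fun ht => ?_⟩
  · have : i.1 ≠ j.1 := fun h => hij (Fin.ext h)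
    omega
  · refine isCollapsibleFace_generatedComplex_iff hM hρ hstart ?_
      (fun p hp => chain_eq_start hd hdL hp) fun p hp B hBp hB hne => chain_ridge hp hBp hB hne
    intro x hx
    simpa [chainFacet, mem_translate] using range_subset_facet_start hx
  · refine (card_generatedComplex_le hM.card_facet).trans ?_
    rw [chainIndex, Finset.card_product, Finset.card_range]
    calc M * G.I.card * 2 ^ (d + 1) = M * (G.I.card * 2 ^ (d + 1)) := by ring
      _ ≤ (5 * t) * (G.I.card * 2 ^ (d + 1)) := Nat.mul_le_mul_right _ (by omega)
      _ = 5 * (G.I.card * 2 ^ (d + 1)) * t := by ring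

end Gadget

end DCollapse

/-! ### The gadget as a union of cones along a walk of `d`-sets. -/

namespace DCollapse

/-- A `d`-dimensional pseudomanifold property: the mod 2 sum of the boundaries of two `d`-simplices
(one of which may be missing) has no free face. -/
theorem exists_ne_of_mem_symmDiff {V : Type*} [DecidableEq V] {d : ℕ} {S T B Q : Finset V}
    (hT : ∀ B ⊆ T, B.card = d → T.card = d + 1) (hS : ∀ B ⊆ S, B.card = d → S.card = d + 1)
    (hB : B.card = d) (hQ : Q.card + 1 = d) (hQB : Q ⊆ B) (hBS : B ⊆ S) (hBT : ¬ B ⊆ T) :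
    ∃ B', B'.card = d ∧ ¬ (B' ⊆ S ↔ B' ⊆ T) ∧ B' ≠ B ∧ Q ⊆ B' := by
  -- In a `d`-simplex exactly two `d`-sets contain a given set of d - 1 vertices.
  have key : ∀ {S B : Finset V}, S.card = d + 1 → B.card = d → Q ⊆ B → B ⊆ S →
      ∃ B', B'.card = d ∧ B' ⊆ S ∧ B' ≠ B ∧ Q ⊆ B' ∧
        ∀ B'', B''.card = d → B'' ⊆ S → Q ⊆ B'' → B'' = B ∨ B'' = B' := by
    intro S B hS hB hQB hBS
    obtain ⟨x, hx, rfl⟩ := (Finset.covBy_iff_exists_insert).1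
      (Finset.covBy_iff_card_sdiff_eq_one.2 ⟨hQB, by rw [Finset.card_sdiff_of_subset hQB]; omega⟩)
    obtain ⟨y, hy, rfl⟩ := (Finset.covBy_iff_exists_insert).1
      (Finset.covBy_iff_card_sdiff_eq_one.2 ⟨hBS, by rw [Finset.card_sdiff_of_subset hBS]; omega⟩)
    have hyx : y ≠ x := fun h => hy (h ▸ Finset.mem_insert_self _ _)
    have hyQ : y ∉ Q := fun h => hy (Finset.mem_insert_of_mem h)
    refine ⟨insert y Q, by rw [Finset.card_insert_of_notMem hyQ, hQ],
      Finset.insert_subset_insert _ (Finset.subset_insert _ _), fun h => hy ?_,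
      Finset.subset_insert _ _, fun B'' hc hs hq => ?_⟩
    · rw [← h]; exact Finset.mem_insert_self _ _
    · obtain ⟨z, hz, rfl⟩ := (Finset.covBy_iff_exists_insert).1
        (Finset.covBy_iff_card_sdiff_eq_one.2 ⟨hq, by rw [Finset.card_sdiff_of_subset hq]; omega⟩)
      have := hs (Finset.mem_insert_self z Q)
      rw [Finset.mem_insert, Finset.mem_insert] at this
      rcases this with rfl | rfl | h
      · exact Or.inr rfl
      · exact Or.inl rfl
      · exact absurd h hz
  obtain ⟨B₁, h1, h2, h3, h4, h5⟩ := key (hS B hBS hB) hB hQB hBS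
  -- If `B₁` cancels, the other `d`-subset of `T` over `Q` does not: in `S` it would have to be `B`
  -- or `B₁`.
  by_cases hB₁ : B₁ ⊆ T
  · obtain ⟨B₂, g1, g2, g3, g4, -⟩ := key (hT B₁ hB₁ h1) h1 h4 hB₁
    have hne : B₂ ≠ B := fun h => hBT (h ▸ g2)
    refine ⟨B₂, g1, fun h => ?_, hne, g4⟩
    rcases h5 B₂ g1 (h.2 g2) g4 with h | h
    · exact hne h
    · exact g3 h
  · exact ⟨B₁, h1, fun h => hB₁ (h.1 h2), h3, h4⟩

/-- Locates the cells containing a `d`-set: they are the places where its containment in the walk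
simplices changes. -/
theorem exists_drop {P : ℕ → Prop} {i j : ℕ} (hij : i ≤ j) (hi : P i) (hj : ¬ P j) :
    ∃ k, i ≤ k ∧ k < j ∧ P k ∧ ¬ P (k + 1) := by
  induction j, hij using Nat.le_induction with
  | base => exact absurd hi hj
  | succ j hij ih =>
    by_cases h : P j
    · exact ⟨j, hij, Nat.lt_succ_self j, h, hj⟩
    · obtain ⟨k, h1, h2, h3⟩ := ih h
      exact ⟨k, h1, Nat.lt_succ_of_lt h2, h3⟩

/-- A sequence `A 0, …, A (N - 1)` of distinct `d`-sets, each of which arises from the one before by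
exchanging an element, that leaves and later revisits the star of every ridge of `A 0`; together
with a vertex `n` and vertices `a j` outside of these sets. -/
structure IsReturningWalk (d N n : ℕ) (A : ℕ → Finset ℕ) (a : ℕ → ℕ) : Prop where
  pos : 0 < d
  pos_length : 0 < N
  card_zero : (A 0).card = d
  step : ∀ j, j + 1 < N → ∃ x ∈ A j, ∃ y, y ∉ A j ∧ A (j + 1) = insert y ((A j).erase x)
  inj : ∀ i < N, ∀ j < N, A i = A j → i = j
  notMem : ∀ j < N, n ∉ A j
  apex_inj : ∀ i < N, ∀ j < N, a i = a j → i = j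
  apex_notMem : ∀ i < N, ∀ j < N, a i ∉ insert n (A j)
  returns : ∀ R ⊆ A 0, R.card + 1 = d → ∃ i k, i < k ∧ k < N ∧ ¬ R ⊆ A i ∧ R ⊆ A k

/-- The `d`-simplex `A j ∪ {n}`, and the empty set behind the end of the walk. -/
def walkSimplex (N n : ℕ) (A : ℕ → Finset ℕ) (j : ℕ) : Finset ℕ :=
  if j < N then insert n (A j) else ∅

/-- The mod 2 sum of the boundaries of two consecutive simplices of a walk. -/
def walkCell (d N n : ℕ) (A : ℕ → Finset ℕ) (j : ℕ) : Finset (Finset ℕ) :=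
  symmDiff (Finset.powersetCard d (walkSimplex N n A j))
    (Finset.powersetCard d (walkSimplex N n A (j + 1)))

theorem mem_walkCell {d N n : ℕ} {A : ℕ → Finset ℕ} {j : ℕ} {B : Finset ℕ} :
    B ∈ walkCell d N n A j ↔
      B.card = d ∧ ¬ (B ⊆ walkSimplex N n A j ↔ B ⊆ walkSimplex N n A (j + 1)) := by
  simp only [walkCell, Finset.mem_symmDiff, Finset.mem_powersetCard]
  tauto

/-- The cone with apex `a j` over a `d`-set of the `j`-th cell. -/
def walkFacet (a : ℕ → ℕ) (p : Σ _ : ℕ, Finset ℕ) : Finset ℕ := insert (a p.1) p.2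

/-- The matching that collapses the cone over the `j`-th cell from `A j`. -/
def walkBase (N n : ℕ) (A : ℕ → Finset ℕ) (a : ℕ → ℕ) (p : Σ _ : ℕ, Finset ℕ) : Finset ℕ :=
  if p.2 = A p.1 then A p.1
  else if p.2 ⊆ walkSimplex N n A p.1 then insert (a p.1) (p.2.erase n)
  else insert (a p.1) (p.2 ∩ walkSimplex N n A p.1)

/-- The order of the collapses. -/
def walkRank (N n : ℕ) (A : ℕ → Finset ℕ) (p : Σ _ : ℕ, Finset ℕ) : ℕ :=
  3 * p.1 + if p.2 = A p.1 then 0 else if p.2 ⊆ walkSimplex N n A p.1 then 1 else 2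

namespace IsReturningWalk

variable {d N n : ℕ} {A : ℕ → Finset ℕ} {a : ℕ → ℕ} {j : ℕ} {B : Finset ℕ}

theorem walkSimplex_eq (hj : j < N) : walkSimplex N n A j = insert n (A j) := if_pos hj

theorem lt_of_subset_walkSimplex (hd : 0 < d) (hB : B.card = d) (h : B ⊆ walkSimplex N n A j) :
    j < N := by
  by_contra hj
  rw [walkSimplex, if_neg hj, Finset.subset_empty] at h
  rw [h, Finset.card_empty] at hB
  omega

theorem mem_walkSimplex (hj : j < N) : n ∈ walkSimplex N n A j := by
  rw [walkSimplex_eq hj]; exact Finset.mem_insert_self _ _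

theorem subset_walkSimplex (hj : j < N) : A j ⊆ walkSimplex N n A j := by
  rw [walkSimplex_eq hj]; exact Finset.subset_insert _ _

variable (W : IsReturningWalk d N n A a)
include W

theorem card_walk : ∀ j < N, (A j).card = d := by
  intro j
  induction j with
  | zero => exact fun _ => W.card_zero
  | succ j ih =>
    intro hj
    obtain ⟨x, hx, y, hy, h⟩ := W.step j hj
    have h1 := ih (by omega)
    have h2 := Finset.card_pos.2 ⟨x, hx⟩
    rw [h, Finset.card_insert_of_notMem fun h => hy (Finset.mem_of_mem_erase h),
      Finset.card_erase_of_mem hx]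
    omega

theorem card_walkSimplex (hj : j < N) : (walkSimplex N n A j).card = d + 1 := by
  rw [walkSimplex_eq hj, Finset.card_insert_of_notMem (W.notMem j hj), W.card_walk j hj]

theorem eq_of_subset (hB : B.card = d) (h : B ⊆ walkSimplex N n A j) (hn : n ∉ B) : B = A j := by
  have hj := lt_of_subset_walkSimplex W.pos hB h
  rw [walkSimplex_eq hj, Finset.subset_insert_iff_of_notMem hn] at h
  exact Finset.eq_of_subset_of_card_le h (by rw [hB, W.card_walk j hj])

theorem eq_of_walk_subset {i : ℕ} (hi : i < N) (h : A i ⊆ walkSimplex N n A j) : i = j :=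
  W.inj i hi j (lt_of_subset_walkSimplex W.pos (W.card_walk i hi) h)
    (W.eq_of_subset (W.card_walk i hi) h (W.notMem i hi))

theorem walk_mem_cell (hj : j < N) : A j ∈ walkCell d N n A j := by
  refine mem_walkCell.2 ⟨W.card_walk j hj, fun h => ?_⟩
  have := W.eq_of_walk_subset hj (h.1 (subset_walkSimplex hj))
  omega

theorem walk_succ_mem_cell (hj : j + 1 < N) : A (j + 1) ∈ walkCell d N n A j := by
  refine mem_walkCell.2 ⟨W.card_walk _ hj, fun h => ?_⟩
  have := W.eq_of_walk_subset hj (h.2 (subset_walkSimplex hj))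
  omega

theorem eq_or_eq_of_walk_mem_cell {i : ℕ} (hi : i < N) (h : A i ∈ walkCell d N n A j) :
    i = j ∨ i = j + 1 := by
  have h := (mem_walkCell.1 h).2
  by_cases h1 : A i ⊆ walkSimplex N n A j
  · exact Or.inl (W.eq_of_walk_subset hi h1)
  · exact Or.inr (W.eq_of_walk_subset hi (by tauto))

/-- Consequently every `d`-set of the j-th cell outside S_j contains the entering vertex `y`. -/
theorem exists_swap (hj : j + 1 < N) :
    ∃ y, y ∉ walkSimplex N n A j ∧ walkSimplex N n A (j + 1) ⊆ insert y (walkSimplex N n A j) := by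
  obtain ⟨x, hx, y, hy, h⟩ := W.step j hj
  rw [walkSimplex_eq hj, walkSimplex_eq (by omega : j < N)]
  refine ⟨y, fun hmem => ?_, ?_⟩
  · rcases Finset.mem_insert.1 hmem with rfl | h'
    · exact W.notMem (j + 1) hj (h ▸ Finset.mem_insert_self _ _)
    · exact hy h'
  · rw [h, Finset.insert_comm]
    exact Finset.insert_subset_insert _ (Finset.insert_subset_insert _ (Finset.erase_subset _ _))

theorem apex_notMem_of_mem_cell {i : ℕ} (hi : i < N) (hB : B ∈ walkCell d N n A j) : a i ∉ B := by
  obtain ⟨hc, h⟩ := mem_walkCell.1 hB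
  have key : ∀ k, B ⊆ walkSimplex N n A k → a i ∉ B := fun k hk hmem => by
    have hkN := lt_of_subset_walkSimplex W.pos hc hk
    rw [walkSimplex_eq hkN] at hk
    exact W.apex_notMem i hi k hkN (hk hmem)
  by_cases h1 : B ⊆ walkSimplex N n A j
  · exact key j h1
  · exact key (j + 1) (by tauto)

theorem exists_inter_eq (hB : B ∈ walkCell d N n A j) (h : ¬ B ⊆ walkSimplex N n A j) :
    B ⊆ walkSimplex N n A (j + 1) ∧ j + 1 < N := by
  obtain ⟨hc, h'⟩ := mem_walkCell.1 hB
  have h1 : B ⊆ walkSimplex N n A (j + 1) := by tauto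
  exact ⟨h1, lt_of_subset_walkSimplex W.pos hc h1⟩

/-- The j-th cone goes in three stages. `A j` frees its own facet, its other cone j - 1 being gone.
Then the facets over B ⊆ S_j with `n` ∈ B are removed through a_j ∪ (B \ {n}), which otherwise can
lie only in the facet over `A j`. Finally B ⊆ S_{j+1} contains the entering vertex y, and any other
facet on a_j ∪ (B \ {y}) is over a subset of S_j. -/
theorem matching : IsAcyclicMatching d ((Finset.range N).sigma (walkCell d N n A)) (walkFacet a)
    (walkBase N n A a) (walkRank N n A) where
  card_facet := by
    rintro ⟨j, B⟩ hp
    obtain ⟨hj, hB⟩ := Finset.mem_sigma.1 hp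
    rw [Finset.mem_range] at hj
    dsimp only at hj hB
    rw [walkFacet, Finset.card_insert_of_notMem (W.apex_notMem_of_mem_cell hj hB),
      (mem_walkCell.1 hB).1]
  card_base := by
    rintro ⟨j, B⟩ hp
    obtain ⟨hj, hB⟩ := Finset.mem_sigma.1 hp
    rw [Finset.mem_range] at hj
    dsimp only at hj hB
    have ha := W.apex_notMem_of_mem_cell hj hB
    have hc := (mem_walkCell.1 hB).1
    have hd := W.pos
    simp only [walkBase]
    split_ifs with h1 h2
    · exact W.card_walk j hj
    · have hn : n ∈ B := by
        by_contra hn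
        exact h1 (W.eq_of_subset hc h2 hn)
      rw [Finset.card_insert_of_notMem fun h => ha (Finset.mem_of_mem_erase h),
        Finset.card_erase_of_mem hn]
      omega
    · obtain ⟨h3, h4⟩ := W.exists_inter_eq hB h2
      obtain ⟨y, hy, hsub⟩ := W.exists_swap h4
      have hyB : y ∈ B := by
        by_contra hyB
        exact h2 ((Finset.subset_insert_iff_of_notMem hyB).1 (h3.trans hsub))
      have : B ∩ walkSimplex N n A j = B.erase y := by
        ext z
        rw [Finset.mem_inter, Finset.mem_erase]
        constructor
        · rintro ⟨hz, hz'⟩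
          exact ⟨fun h => hy (h ▸ hz'), hz⟩
        · rintro ⟨hz, hz'⟩
          exact ⟨hz', (Finset.mem_insert.1 (hsub (h3 hz'))).resolve_left hz⟩
      rw [Finset.card_insert_of_notMem fun h => ha (Finset.mem_inter.1 h).1, this,
        Finset.card_erase_of_mem hyB]
      omega
  base_subset := by
    rintro ⟨j, B⟩ -
    simp only [walkBase, walkFacet]
    split_ifs with h1 h2
    · rw [h1]; exact Finset.subset_insert _ _
    · exact Finset.insert_subset_insert _ (Finset.erase_subset _ _)
    · exact Finset.insert_subset_insert _ Finset.inter_subset_left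
  acyclic := by
    rintro ⟨j, B⟩ hp ⟨k, C⟩ hq h
    obtain ⟨hj, hB⟩ := Finset.mem_sigma.1 hp
    obtain ⟨hk, hC⟩ := Finset.mem_sigma.1 hq
    rw [Finset.mem_range] at hj hk
    dsimp only at hj hB hk hC
    have hcB := (mem_walkCell.1 hB).1
    have hcC := (mem_walkCell.1 hC).1
    have hcone : ∀ {S : Finset ℕ}, insert (a j) S ⊆ insert (a k) C → S ⊆ B → j = k ∧ S ⊆ C := by
      intro S hS hSB
      have hjk : j = k := by
        rcases Finset.mem_insert.1 (hS (Finset.mem_insert_self _ _)) with h | h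
        · exact W.apex_inj j hj k hk h
        · exact absurd h (W.apex_notMem_of_mem_cell hj hC)
      refine ⟨hjk, fun x hx => ?_⟩
      rcases Finset.mem_insert.1 (hS (Finset.mem_insert_of_mem hx)) with h | h
      · exact absurd (hSB hx) (h ▸ W.apex_notMem_of_mem_cell hk hB)
      · exact h
    simp only [walkBase, walkFacet] at h
    split_ifs at h with h1 h2
    · have haj : a k ∉ A j := fun h' =>
        W.apex_notMem k hk j hj (Finset.mem_insert_of_mem h')
      rw [Finset.subset_insert_iff_of_notMem haj] at h
      have hAC : A j = C := Finset.eq_of_subset_of_card_le h (by rw [hcC, W.card_walk j hj])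
      rcases W.eq_or_eq_of_walk_mem_cell hj (hAC ▸ hC) with rfl | rfl
      · left; rw [h1, hAC]
      · right
        simp only [walkRank]
        split_ifs <;> omega
    · obtain ⟨rfl, hs⟩ := hcone h (Finset.erase_subset _ _)
      by_cases h3 : C = A j
      · right; simp only [walkRank, if_pos h3, if_neg h1, if_pos h2]; omega
      left
      by_cases h4 : C ⊆ walkSimplex N n A j
      · have hn : n ∈ C := by
          by_contra hn
          exact h3 (W.eq_of_subset hcC h4 hn)
        have hBC : B ⊆ C := fun x hx => by
          by_cases hxn : x = n
          · rwa [hxn]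
          · exact hs (Finset.mem_erase.2 ⟨hxn, hx⟩)
        rw [Finset.eq_of_subset_of_card_le hBC (by rw [hcB, hcC])]
      · obtain ⟨h5, h6⟩ := W.exists_inter_eq hC h4
        -- Here `B` would lie in both simplices, because both contain `n`, and so would have
        -- cancelled.
        refine absurd ⟨fun _ x hx => ?_, fun _ => h2⟩ (mem_walkCell.1 hB).2
        by_cases hxn : x = n
        · rw [hxn]; exact mem_walkSimplex h6
        · exact h5 (hs (Finset.mem_erase.2 ⟨hxn, hx⟩))
    · obtain ⟨rfl, hs⟩ := hcone h Finset.inter_subset_left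
      by_cases h3 : C = A j
      · right; simp only [walkRank, if_pos h3, if_neg h1, if_neg h2]; omega
      by_cases h4 : C ⊆ walkSimplex N n A j
      · right; simp only [walkRank, if_neg h3, if_pos h4, if_neg h1, if_neg h2]; omega
      left
      obtain ⟨h5, h6⟩ := W.exists_inter_eq hC h4
      obtain ⟨h7, -⟩ := W.exists_inter_eq hB h2
      obtain ⟨y, hy, hsub⟩ := W.exists_swap h6
      have hyC : y ∈ C := by
        by_contra hyC
        exact h4 ((Finset.subset_insert_iff_of_notMem hyC).1 (h5.trans hsub))
      have hBC : B ⊆ C := fun x hx => by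
        rcases Finset.mem_insert.1 (hsub (h7 hx)) with rfl | h'
        · exact hyC
        · exact hs (Finset.mem_inter.2 ⟨hx, h'⟩)
      rw [Finset.eq_of_subset_of_card_le hBC (by rw [hcB, hcC])]

theorem exists_two_cells (hB : B ∈ walkCell d N n A j) (hB0 : B ≠ A 0) :
    ∃ i < N, ∃ k < N, i ≠ k ∧ B ∈ walkCell d N n A i ∧ B ∈ walkCell d N n A k := by
  obtain ⟨hc, hne⟩ := mem_walkCell.1 hB
  obtain ⟨m, hm⟩ : ∃ m, B ⊆ walkSimplex N n A m := by
    by_cases h : B ⊆ walkSimplex N n A j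
    · exact ⟨j, h⟩
    · exact ⟨j + 1, by tauto⟩
  have hmN := lt_of_subset_walkSimplex W.pos hc hm
  by_cases hn : n ∈ B
  · have hN : ¬ B ⊆ walkSimplex N n A N := fun h =>
      lt_irrefl _ (lt_of_subset_walkSimplex W.pos hc h)
    by_cases h0 : B ⊆ walkSimplex N n A 0
    · have hsub : B.erase n ⊆ A 0 := by
        rw [walkSimplex_eq W.pos_length] at h0
        exact Finset.subset_insert_iff.1 h0
      have hd := W.pos
      -- A `d`-set of the first simplex has no moment of entering to count; it is left once before
      -- step `i` and again from step `k` on.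
      obtain ⟨i, k, hik, hk, hi, hk'⟩ := W.returns _ hsub (by
        rw [Finset.card_erase_of_mem hn, hc]; omega)
      have hi' : ¬ B ⊆ walkSimplex N n A i := fun h => by
        rw [walkSimplex_eq (by omega), Finset.subset_insert_iff] at h
        exact hi h
      have hk'' : B ⊆ walkSimplex N n A k := by
        rw [walkSimplex_eq hk, Finset.subset_insert_iff]
        exact hk'
      obtain ⟨p, hp1, hp2, hp3, hp4⟩ :=
        exists_drop (P := fun m => B ⊆ walkSimplex N n A m) (Nat.zero_le i) h0 hi'
      obtain ⟨q, hq1, hq2, hq3, hq4⟩ :=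
        exists_drop (P := fun m => B ⊆ walkSimplex N n A m) hk.le hk'' hN
      exact ⟨p, by omega, q, hq2, by omega, mem_walkCell.2 ⟨hc, fun h => hp4 (h.1 hp3)⟩,
        mem_walkCell.2 ⟨hc, fun h => hq4 (h.1 hq3)⟩⟩
    · obtain ⟨p, hp1, hp2, hp3, hp4⟩ :=
        exists_drop (P := fun m => ¬ B ⊆ walkSimplex N n A m) (Nat.zero_le m) h0 (not_not.2 hm)
      obtain ⟨q, hq1, hq2, hq3, hq4⟩ :=
        exists_drop (P := fun m => B ⊆ walkSimplex N n A m) hmN.le hm hN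
      exact ⟨p, by omega, q, hq2, by omega, mem_walkCell.2 ⟨hc, fun h => hp4 (hp3 <| h.2 ·)⟩,
        mem_walkCell.2 ⟨hc, fun h => hq4 (h.1 hq3)⟩⟩
  · obtain rfl := W.eq_of_subset hc hm hn
    cases m with
    | zero => exact absurd rfl hB0
    | succ m =>
      exact ⟨m, by omega, m + 1, hmN, by omega, W.walk_succ_mem_cell hmN, W.walk_mem_cell hmN⟩

/-- Through the apex, a second facet exists because the cell is a mod 2 cycle; away from it, `Q` is
itself in the cell and lies in a second cell. -/
theorem ridge : ∀ p ∈ (Finset.range N).sigma (walkCell d N n A), ∀ Q ⊆ walkFacet a p,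
    Q.card = d → Q ≠ A 0 → ∃ q ∈ (Finset.range N).sigma (walkCell d N n A),
      ∃ r ∈ (Finset.range N).sigma (walkCell d N n A), q ≠ r ∧ Q ⊆ walkFacet a q ∧
        Q ⊆ walkFacet a r := by
  rintro ⟨j, B⟩ hp Q hQB hQ hQ0
  obtain ⟨hj, hB⟩ := Finset.mem_sigma.1 hp
  rw [Finset.mem_range] at hj
  dsimp only at hj hB
  rw [walkFacet] at hQB
  by_cases ha : a j ∈ Q
  · have hd := W.pos
    have hsub : Q.erase (a j) ⊆ B := Finset.subset_insert_iff.1 hQB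
    have hcard : (Q.erase (a j)).card + 1 = d := by rw [Finset.card_erase_of_mem ha]; omega
    obtain ⟨hc, hne⟩ := mem_walkCell.1 hB
    have hT : ∀ k, ∀ B ⊆ walkSimplex N n A k, B.card = d → (walkSimplex N n A k).card = d + 1 :=
      fun k B h hB => W.card_walkSimplex (lt_of_subset_walkSimplex W.pos hB h)
    obtain ⟨B', h1, h2, h3, h4⟩ : ∃ B', B'.card = d ∧
        ¬ (B' ⊆ walkSimplex N n A j ↔ B' ⊆ walkSimplex N n A (j + 1)) ∧ B' ≠ B ∧
        Q.erase (a j) ⊆ B' := by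
      by_cases h : B ⊆ walkSimplex N n A j
      · exact exists_ne_of_mem_symmDiff (hT (j + 1)) (hT j) hc hcard hsub h (by tauto)
      · obtain ⟨B', h1, h2, h3⟩ := exists_ne_of_mem_symmDiff (hT j) (hT (j + 1)) hc hcard hsub
          (by tauto) h
        exact ⟨B', h1, fun h => h2 h.symm, h3⟩
    refine ⟨⟨j, B⟩, hp, ⟨j, B'⟩, Finset.mem_sigma.2 ⟨Finset.mem_range.2 hj,
      mem_walkCell.2 ⟨h1, h2⟩⟩, fun h => h3 ?_, hQB, Finset.subset_insert_iff.2 h4⟩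
    exact (eq_of_heq (Sigma.mk.inj h).2).symm
  · rw [Finset.subset_insert_iff_of_notMem ha] at hQB
    obtain rfl : Q = B :=
      Finset.eq_of_subset_of_card_le hQB (by rw [hQ, (mem_walkCell.1 hB).1])
    obtain ⟨i, hi, k, hk, hik, h1, h2⟩ := W.exists_two_cells hB hQ0
    exact ⟨⟨i, Q⟩, Finset.mem_sigma.2 ⟨Finset.mem_range.2 hi, h1⟩, ⟨k, Q⟩,
      Finset.mem_sigma.2 ⟨Finset.mem_range.2 hk, h2⟩, fun h => hik (Sigma.mk.inj h).1,
      Finset.subset_insert _ _, Finset.subset_insert _ _⟩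

theorem subset_facet (hB : B.card = d) (h : B ⊆ walkSimplex N n A j) :
    ∃ p ∈ (Finset.range N).sigma (walkCell d N n A), B ⊆ walkFacet a p := by
  obtain ⟨q, hq1, hq2, hq3, hq4⟩ := exists_drop (P := fun m => B ⊆ walkSimplex N n A m)
    (lt_of_subset_walkSimplex W.pos hB h).le h fun h =>
      lt_irrefl _ (lt_of_subset_walkSimplex W.pos hB h)
  exact ⟨⟨q, B⟩, Finset.mem_sigma.2 ⟨Finset.mem_range.2 hq2,
    mem_walkCell.2 ⟨hB, fun h => hq4 (h.1 hq3)⟩⟩, Finset.subset_insert _ _⟩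

/-- Every base either is some `A k`, which avoids `n`, or contains an apex, which no walk simplex
does. -/
theorem base_ne (hn : n ∈ B) (hj : j < N) (h : B ⊆ walkSimplex N n A j) :
    ∀ p ∈ (Finset.range N).sigma (walkCell d N n A), walkBase N n A a p ≠ B := by
  rintro ⟨k, C⟩ hp rfl
  have hk := Finset.mem_range.1 (Finset.mem_sigma.1 hp).1
  dsimp only at hk
  rw [walkSimplex_eq hj] at h
  simp only [walkBase] at hn h
  split_ifs at hn h
  · exact W.notMem k hk hn
  · exact W.apex_notMem k hk j hj (h (Finset.mem_insert_self _ _))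
  · exact W.apex_notMem k hk j hj (h (Finset.mem_insert_self _ _))

theorem eq_start : ∀ p ∈ (Finset.range N).sigma (walkCell d N n A), A 0 ⊆ walkFacet a p →
    p = ⟨0, A 0⟩ := by
  rintro ⟨j, B⟩ hp h
  obtain ⟨hj, hB⟩ := Finset.mem_sigma.1 hp
  rw [Finset.mem_range] at hj
  dsimp only at hj hB
  rw [walkFacet, Finset.subset_insert_iff_of_notMem fun h =>
    W.apex_notMem j hj 0 W.pos_length (Finset.mem_insert_of_mem h)] at h
  obtain rfl : A 0 = B :=
    Finset.eq_of_subset_of_card_le h (by rw [W.card_zero, (mem_walkCell.1 hB).1])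
  rcases W.eq_or_eq_of_walk_mem_cell W.pos_length hB with rfl | h
  · rfl
  · omega

theorem facet_lt {M : ℕ} (hn : n < M) (hA : ∀ j < N, ∀ x ∈ A j, x < M) (ha : ∀ j < N, a j < M) :
    ∀ p ∈ (Finset.range N).sigma (walkCell d N n A), ∀ x ∈ walkFacet a p, x < M := by
  rintro ⟨j, B⟩ hp x hx
  obtain ⟨hj, hB⟩ := Finset.mem_sigma.1 hp
  rw [Finset.mem_range] at hj
  dsimp only at hj hB
  obtain ⟨hc, hne⟩ := mem_walkCell.1 hB
  have key : ∀ k, B ⊆ walkSimplex N n A k → x ∈ B → x < M := fun k hk hmem => by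
    have hkN := lt_of_subset_walkSimplex W.pos hc hk
    rw [walkSimplex_eq hkN] at hk
    rcases Finset.mem_insert.1 (hk hmem) with rfl | h
    · exact hn
    · exact hA k hkN x h
  rcases Finset.mem_insert.1 hx with rfl | hx
  · exact ha j hj
  · by_cases h : B ⊆ walkSimplex N n A j
    · exact key j h hx
    · exact key (j + 1) (by tauto) hx

end IsReturningWalk

/-! ### An explicit returning walk and the resulting gadget. -/

/-- A walk that starts at `{0, …, d - 1}`, leaves it in two steps, visits the sets
`{0, …, d - 1, d + 1} \ {i}`, and ends at `{d + 1, 3 d + 4, …, 4 d + 2}`. -/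
def standardWalk (d j : ℕ) : Finset ℕ :=
  (Finset.range (4 * d + 3)).filter fun x =>
    (j = 0 ∧ x < d) ∨ (j = 1 ∧ (x < d - 1 ∨ x = d)) ∨
    (j = 2 ∧ (x < d - 2 ∨ x = d ∨ x = d + 1)) ∨
    (3 ≤ j ∧ j < d + 3 ∧ (x = d + 1 ∨ (x < d ∧ x ≠ d + 2 - j))) ∨
    (d + 3 ≤ j ∧ (x = d + 1 ∨ (j - d - 1 ≤ x ∧ x < d) ∨ (3 * d + 4 ≤ x ∧ x < 2 * d + 2 + j)))

theorem mem_standardWalk {d j x : ℕ} : x ∈ standardWalk d j ↔ x < 4 * d + 3 ∧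
    ((j = 0 ∧ x < d) ∨ (j = 1 ∧ (x < d - 1 ∨ x = d)) ∨
    (j = 2 ∧ (x < d - 2 ∨ x = d ∨ x = d + 1)) ∨
    (3 ≤ j ∧ j < d + 3 ∧ (x = d + 1 ∨ (x < d ∧ x ≠ d + 2 - j))) ∨
    (d + 3 ≤ j ∧ (x = d + 1 ∨ (j - d - 1 ≤ x ∧ x < d) ∨
      (3 * d + 4 ≤ x ∧ x < 2 * d + 2 + j)))) := by
  rw [standardWalk, Finset.mem_filter, Finset.mem_range]

theorem standardWalk_zero (d : ℕ) : standardWalk d 0 = Finset.range d := by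
  ext x
  rw [mem_standardWalk, Finset.mem_range]
  omega

theorem standardWalk_step {d : ℕ} (hd : 2 ≤ d) (j : ℕ) (hj : j + 1 < 2 * d + 2) :
    ∃ x ∈ standardWalk d j, ∃ y, y ∉ standardWalk d j ∧
      standardWalk d (j + 1) = insert y ((standardWalk d j).erase x) := by
  have key : ∀ x y, x ∈ standardWalk d j → y ∉ standardWalk d j →
      (∀ z, z ∈ standardWalk d (j + 1) ↔ z = y ∨ (z ≠ x ∧ z ∈ standardWalk d j)) →
      ∃ x ∈ standardWalk d j, ∃ y, y ∉ standardWalk d j ∧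
        standardWalk d (j + 1) = insert y ((standardWalk d j).erase x) := fun x y hx hy h =>
    ⟨x, hx, y, hy, by ext z; rw [h, Finset.mem_insert, Finset.mem_erase]⟩
  -- Two exchanges leave the start; the third brings `d - 2` back for `d`; then the missing element
  -- slides from `d - 1` down to 0; finally 1, …, d - 1 are traded for 3d + 4, …, 4d + 2.
  rcases (by omega :
      j = 0 ∨ j = 1 ∨ j = 2 ∨ (3 ≤ j ∧ j < d + 2) ∨ d + 2 ≤ j) with h | h | h | h | h
  · refine key (d - 1) d ?_ ?_ (fun z => ⟨?_, ?_⟩) <;> simp only [mem_standardWalk] <;> omega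
  · refine key (d - 2) (d + 1) ?_ ?_ (fun z => ⟨?_, ?_⟩) <;> simp only [mem_standardWalk] <;> omega
  · have hy : d - 2 ∉ standardWalk d j := fun h' => by
      rcases (mem_standardWalk.1 h').2 with h' | h' | h' | h' | h' <;> omega
    refine key d (d - 2) (mem_standardWalk.2 (by omega)) hy (fun z => ?_)
    rw [mem_standardWalk, mem_standardWalk, h]
    constructor
    · intro h'
      omega
    · rintro (rfl | ⟨h1, h2, h3⟩)
      · omega
      · omega
  · refine key (d + 1 - j) (d + 2 - j) ?_ ?_ (fun z => ⟨?_, ?_⟩) <;> simp only [mem_standardWalk] <;> omega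
  · refine key (j - d - 1) (2 * d + 2 + j) ?_ ?_ (fun z => ⟨?_, ?_⟩) <;> simp only [mem_standardWalk] <;> omega

theorem standardWalk_ne {d : ℕ} (hd : 2 ≤ d) {i j : ℕ} (hij : i < j) (hj : j < 2 * d + 2) :
    standardWalk d i ≠ standardWalk d j := by
  suffices ∃ x, ¬ (x ∈ standardWalk d i ↔ x ∈ standardWalk d j) by
    obtain ⟨x, hx⟩ := this
    exact fun h => hx (by rw [h])
  rcases (by omega : (i = 0 ∧ j < 3) ∨ (i < 2 ∧ 2 ≤ j) ∨ i = 2 ∨ (3 ≤ i ∧ j < d + 3) ∨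
      (3 ≤ i ∧ i < d + 2 ∧ d + 3 ≤ j) ∨ d + 2 ≤ i) with h | h | h | h | h | h
  · refine ⟨d, fun h' => ?_⟩
    have := h'.2 (mem_standardWalk.2 (by omega))
    rw [mem_standardWalk] at this
    omega
  · refine ⟨d + 1, fun h' => ?_⟩
    have := h'.2 (mem_standardWalk.2 (by omega))
    rw [mem_standardWalk] at this
    omega
  · refine ⟨d, fun h' => ?_⟩
    have := h'.1 (mem_standardWalk.2 (by omega))
    rw [mem_standardWalk] at this
    omega
  · refine ⟨d + 2 - i, fun h' => ?_⟩
    have := h'.2 (mem_standardWalk.2 (by omega))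
    rw [mem_standardWalk] at this
    omega
  · refine ⟨3 * d + 4, fun h' => ?_⟩
    have := h'.2 (mem_standardWalk.2 (by omega))
    rw [mem_standardWalk] at this
    omega
  · refine ⟨2 * d + 2 + i, fun h' => ?_⟩
    have := h'.2 (mem_standardWalk.2 (by omega))
    rw [mem_standardWalk] at this
    omega

theorem isReturningWalk_standardWalk {d : ℕ} (hd : 2 ≤ d) :
    IsReturningWalk d (2 * d + 2) (4 * d + 3) (standardWalk d) (fun j => d + 2 + j) where
  pos := by omega
  pos_length := by omega
  card_zero := by rw [standardWalk_zero, Finset.card_range]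
  step := standardWalk_step hd
  inj i hi j hj h := by
    rcases lt_trichotomy i j with hij | hij | hij
    · exact absurd h (standardWalk_ne hd hij hj)
    · exact hij
    · exact absurd h.symm (standardWalk_ne hd hij hi)
  notMem j _ h := by have := (mem_standardWalk.1 h).1; omega
  apex_inj i _ j _ h := by omega
  apex_notMem i hi j hj h := by
    rw [Finset.mem_insert, mem_standardWalk] at h
    omega
  returns R hR hc := by
    rw [standardWalk_zero] at hR
    obtain ⟨x, hx, hx'⟩ := (Finset.covBy_iff_exists_insert).1
      (Finset.covBy_iff_card_sdiff_eq_one.2 ⟨hR, by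
        rw [Finset.card_sdiff_of_subset hR, Finset.card_range]; omega⟩)
    have hmem : ∀ y, y < d ↔ y = x ∨ y ∈ R := fun y => by
      rw [← Finset.mem_range, ← hx', Finset.mem_insert]
    have hxd := (hmem x).2 (Or.inl rfl)
    -- At time 2 only d - 2 elements of the start are left, too few for any ridge; at time `d + 2 -
    -- x` all of them except `x` are present.
    refine ⟨2, d + 2 - x, by omega, by omega, fun h => ?_, fun y hy => ?_⟩
    · have h1 : ∀ y ∈ R, y < d - 2 := fun y hy => by
        have h1 := mem_standardWalk.1 (h hy)
        have h2 := (hmem y).2 (Or.inr hy)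
        omega
      rcases (hmem (d - 1)).1 (by omega) with h2 | h2
      · rcases (hmem (d - 2)).1 (by omega) with h3 | h3
        · omega
        · exact absurd (h1 _ h3) (by omega)
      · exact absurd (h1 _ h2) (by omega)
    · have h1 := (hmem y).2 (Or.inr hy)
      have h2 : y ≠ x := fun h => hx (h ▸ hy)
      rw [mem_standardWalk]
      omega

/-- The vertices are the entry 0, …, d - 1, the auxiliary d and d + 1, the 2d + 2 apexes d + 2, …,
3d + 3, and the exit 3d + 4, …, 4d + 3, whose last vertex is `n`. Exit and target both contain `n`
and lie in walk simplices, the last and the first one, so `base_ne` applies to them. -/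
theorem exists_gadget {d : ℕ} (hd : 2 ≤ d) : Nonempty (Gadget d (3 * d + 4)) := by
  have W := isReturningWalk_standardWalk hd
  have htarget : (insert (4 * d + 3) (Finset.range (d - 1))).card = d := by
    rw [Finset.card_insert_of_notMem (by rw [Finset.mem_range]; omega), Finset.card_range]
    omega
  have htsub : insert (4 * d + 3) (Finset.range (d - 1)) ⊆
      walkSimplex (2 * d + 2) (4 * d + 3) (standardWalk d) 0 := by
    rw [IsReturningWalk.walkSimplex_eq (by omega), standardWalk_zero]
    exact Finset.insert_subset_insert _ (Finset.range_mono (by omega))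
  have hexit : (Finset.Ico (3 * d + 4) (3 * d + 4 + d)).card = d := by
    rw [Nat.card_Ico]; omega
  have hesub : Finset.Ico (3 * d + 4) (3 * d + 4 + d) ⊆
      walkSimplex (2 * d + 2) (4 * d + 3) (standardWalk d) (2 * d + 1) := by
    intro x hx
    rw [IsReturningWalk.walkSimplex_eq (by omega), Finset.mem_insert, mem_standardWalk]
    rw [Finset.mem_Ico] at hx
    omega
  exact ⟨{
    ι := Σ _ : ℕ, Finset ℕ
    I := (Finset.range (2 * d + 2)).sigma (walkCell d (2 * d + 2) (4 * d + 3) (standardWalk d))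
    facet := walkFacet fun j => d + 2 + j
    base := walkBase (2 * d + 2) (4 * d + 3) (standardWalk d) fun j => d + 2 + j
    rank := walkRank (2 * d + 2) (4 * d + 3) (standardWalk d)
    matching := W.matching
    facet_lt := W.facet_lt (by omega) (fun j _ x hx => by
      have := (mem_standardWalk.1 hx).1
      omega) fun j hj => by omega
    start := ⟨0, standardWalk d 0⟩
    start_mem := Finset.mem_sigma.2 ⟨Finset.mem_range.2 W.pos_length, W.walk_mem_cell W.pos_length⟩
    base_start := by simp only [walkBase, if_true, standardWalk_zero]
    eq_start := by simpa only [standardWalk_zero] using W.eq_start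
    ridge := by simpa only [standardWalk_zero] using W.ridge
    exit_subset := W.subset_facet hexit hesub
    base_ne_exit := W.base_ne (by rw [Finset.mem_Ico]; omega) (by omega) hesub
    target := insert (4 * d + 3) (Finset.range (d - 1))
    card_target := htarget
    target_subset := W.subset_facet htarget htsub
    base_ne_target := W.base_ne (Finset.mem_insert_self _ _) W.pos_length htsub
    target_ne_exit := fun h => by
      have h0 : 0 ∈ insert (4 * d + 3) (Finset.range (d - 1)) :=
        Finset.mem_insert_of_mem (Finset.mem_range.2 (by omega))
      rw [h, Finset.mem_Ico] at h0
      omega }⟩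

end DCollapse

theorem mainTheorem3 (d : ℕ) (hd : 2 ≤ d) :
    ∃ c : ℕ, ∀ t : ℕ,
      ∃ (V : Type) (_ : DecidableEq V) (C : Finset (Finset V))
        (ρ : Finset V) (ζ : Fin t → Finset V),
        DCollapse.IsComplex C ∧ DCollapse.HasDim C d ∧
        -- `(d - 1)`-dimensional, pairwise distant faces
        (ρ ∈ C ∧ DCollapse.faceDim ρ = (d : ℤ) - 1 ∧
          (∀ i, ζ i ∈ C ∧ DCollapse.faceDim (ζ i) = (d : ℤ) - 1) ∧
          (∀ i, DCollapse.Distant C ρ (ζ i)) ∧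
          (∀ i j, i ≠ j → DCollapse.Distant C (ζ i) (ζ j))) ∧
        -- the `d`-collapsings
        (DCollapse.CollapsesTo d C (DCollapse.unionOfSimplices ρ ζ \ {ρ}) ∧
          DCollapse.IsCollapsible d (DCollapse.unionOfSimplices ρ ζ \ {ρ}) ∧
          DCollapse.IsCollapsible d C) ∧
        -- the only `d`-collapsible face
        (∀ σ, DCollapse.IsCollapsibleFace d C σ ↔ σ = ρ) ∧
        -- the number of faces is `O(t)`
        (1 ≤ t → C.card ≤ c * t) := by
  obtain ⟨G⟩ := DCollapse.exists_gadget hd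
  exact G.exists_complex (by omega) (by omega)
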